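/- Let $m\ge 2$, let $X\subseteq\mathbb R^m$ be open and bounded, and let $Y=(0,\bar y)$ with $\bar y>0$. Let $c\in C^2(\bar X\times\bar Y)$ satisfy the twist condition ($y\mapsto D_xc(x,y)$ is injective on $Y$ for each $x\in X$) and the non-degeneracy condition ($D^2_{xy}c(x,y)\neq0$ for all $(x,y)\in\bar X\times\bar Y$). Let $\mu$ be a probability measure on $X$ that is absolutely continuous with respect to Lebesgue measure. Let $f:[0,\infty)\to\mathbb R$ be strictly convex, continuously differentiable on $(0,\infty)$, with $f(t)/t\to+\infty$ as $t\to\infty$ and $f'(t)\to-\infty$ as $t\to0^+$; then $f':(0,\infty)\to\mathbb R$ is a bijection with inverse $(f')^{-1}$. Let $\nu$ minimize $$\nu\mapsto \mathcal T_c(\mu,\nu)+\int_Y f(\bar\nu(y))\,dy$$ over all probability measures on $\bar Y$, where $\mathcal T_c(\mu,\nu)=\inf_{\gamma}\int c\,d\gamma$ is the infimum over couplings $\gamma$ of $\mu$ and $\nu$, $\bar\nu$ is the Lebesgue density of $\nu$, and the second term is $+\infty$ if $\nu$ is not absolutely continuous. For $y\in Y$ and $k\in\mathbb R$ put $X_\ge(y,k)=\{x\in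 X:\partial_yc(x,y)\ge k\}$ and $X_>(y,k)=\{x\in X:\partial_yc(x,y)>k\}$. For $y_0<y_1$ in $Y$ and $k_0\in\mathbb R$ put $k_{max}(y_0,y_1,k_0)=\sup\{k: X_\ge(y_0,k_0)\subseteq X_\ge(y_1,k)\}$ and $$D^{min}_\mu(y_0,y_1,k_0)=\mu\big(X_\ge(y_1,k_{max}(y_0,y_1,k_0))\setminus X_\ge(y_0,k_0)\big).$$ Let $M_c=\sup\{|c(x,y_0)-c(x,y_1)|/|y_0-y_1| : x\in\bar X,\ y_0\ne y_1\in\bar Y\}$, and for a bounded measurable $v:Y\to\mathbb R$ let $K_v:(0,\infty)\to\mathbb R$ be the inverse of $z\mapsto\int_Y(f')^{-1}(z-v(y))\,dy$. Then there is a function $k:Y\to\mathbb R$ with $$\mu\big(X_\ge(y,k(y))\big)=\nu((-\infty,y])\qquad\text{for all } y\in Y,$$ and for every such $k$ the following holds: if for every $y_0\in Y$ $$\sup_{y_1\in Y,\ y_1>y_0,\ y_0\le y\le y_1}\left[\frac{D^{min}_\mu(y_0,y_1,k(y_0))}{y_1-y_0}-(f')^{-1}\big(K_{-M_cy}(1)-M_cy\big)\right]<0,$$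 where $K_{-M_cy}$ is $K_v$ for the function $v(y)=-M_cy$, then $(c,\mu,\nu)$ is nested: for all $y_0<y_1$ in $Y$ with $\nu([y_0,y_1])>0$, $$X_\ge(y_0,k(y_0))\subseteq X_>(y_1,k(y_1)).$$ -/

import Mathlib

open MeasureTheory Filter Topology

noncomputable section

namespace Congestion

/-- The Euclidean space `ℝᵐ`. -/
abbrev E (m : ℕ) : Type := EuclideanSpace ℝ (Fin m)

/-! ### The cost -/

/-- `g ∈ C²(closure Ω)` for an open set `Ω`: `g` is `C²` in `Ω`, continuous on the closure, and all
its derivatives of order at most two extend continuously from `Ω` to the closure. -/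
structure IsC2OnClosure {F : Type*} [NormedAddCommGroup F] [NormedSpace ℝ F]
    (Ω : Set F) (g : F → ℝ) : Prop where
  contDiffOn : ContDiffOn ℝ 2 g Ω
  continuousOn : ContinuousOn g (closure Ω)
  extend : ∀ i : ℕ, i ≤ 2 →
    ∃ G, ContinuousOn G (closure Ω) ∧ Set.EqOn G (iteratedFDeriv ℝ i g) Ω

variable {m : ℕ}

/-- Twist condition: for each `x ∈ X` the map `y ↦ D_x c(x, y)` is injective on `Y`. -/
def Twist (X : Set (E m)) (Y : Set ℝ) (c : E m → ℝ → ℝ) : Prop :=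
  ∀ x ∈ X, Set.InjOn (fun y => fderiv ℝ (fun x' => c x' y) x) Y

/-- `∂c/∂y (x, y)`. -/
def dy (c : E m → ℝ → ℝ) (x : E m) (y : ℝ) : ℝ := deriv (c x) y

/-- The mixed derivative `D²_{xy} c (x, y)`, a linear form on `ℝᵐ`. -/
def mixed (c : E m → ℝ → ℝ) (p : E m × ℝ) : E m →L[ℝ] ℝ :=
  fderiv ℝ (fun x' => dy c x' p.2) p.1

/-- Non-degeneracy: `D²_{xy} c`, extended by continuity to `closure X × closure Y`, has full rank
there; as the target is one-dimensional, full rank means nonzero. -/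
def Nondegenerate (X : Set (E m)) (Y : Set ℝ) (c : E m → ℝ → ℝ) : Prop :=
  ∀ p ∈ closure X ×ˢ closure Y, extendFrom (X ×ˢ Y) (mixed c) p ≠ 0

/-- `M_c`, the best global Lipschitz constant of `y ↦ c(x, y)` on `closure Y`, over all
`x ∈ closure X`. The pairs `y₀ = y₁` contribute the harmless value `0 / 0 = 0`. -/
def lipConst (X : Set (E m)) (Y : Set ℝ) (c : E m → ℝ → ℝ) : ℝ :=
  sSup {r | ∃ x ∈ closure X, ∃ y₀ ∈ closure Y, ∃ y₁ ∈ closure Y,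
    r = |c x y₀ - c x y₁| / |y₀ - y₁|}

/-! ### Level sets, the splitting function, nestedness -/

/-- The super-level set `X_≥(y, k)`. -/
def superGE (X : Set (E m)) (c : E m → ℝ → ℝ) (y k : ℝ) : Set (E m) :=
  {x ∈ X | k ≤ dy c x y}

/-- The strict super-level set `X_>(y, k)`. -/
def superGT (X : Set (E m)) (c : E m → ℝ → ℝ) (y k : ℝ) : Set (E m) :=
  {x ∈ X | k < dy c x y}

/-- `k` splits the mass proportionately: `μ(X_≥(y, k(y))) = ν((-∞, y])` for all `y ∈ Y`. -/
def IsSplitting (X : Set (E m)) (Y : Set ℝ) (c : E m → ℝ → ℝ) (μ : Measure (E m))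
    (ν : Measure ℝ) (k : ℝ → ℝ) : Prop :=
  ∀ y ∈ Y, μ (superGE X c y (k y)) = ν (Set.Iic y)

/-- Nestedness of the model whose mass-splitting function is `k`. -/
def IsNested (X : Set (E m)) (Y : Set ℝ) (c : E m → ℝ → ℝ) (ν : Measure ℝ) (k : ℝ → ℝ) : Prop :=
  ∀ y₀ ∈ Y, ∀ y₁ ∈ Y, y₀ < y₁ → 0 < ν (Set.Icc y₀ y₁) →
    superGE X c y₀ (k y₀) ⊆ superGT X c y₁ (k y₁)

/-- `k_max(y₀, y₁, k₀)`. The set is nonempty and bounded above whenever `∂c/∂y` is bounded and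
`X_≥(y₀, k₀)` is nonempty. -/
def kMax (X : Set (E m)) (c : E m → ℝ → ℝ) (y₀ y₁ k₀ : ℝ) : ℝ :=
  sSup {k | superGE X c y₀ k₀ ⊆ superGE X c y₁ k}

/-- The minimal mass difference `D^min_μ(y₀, y₁, k₀)`. -/
def minMassDiff (X : Set (E m)) (c : E m → ℝ → ℝ) (μ : Measure (E m)) (y₀ y₁ k₀ : ℝ) : ℝ :=
  μ.real (superGE X c y₁ (kMax X c y₀ y₁ k₀) \ superGE X c y₀ k₀)

/-! ### The variational problem -/

/-- Transport plans between `μ` and `ν`. -/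
def plans (μ : Measure (E m)) (ν : Measure ℝ) : Set (Measure (E m × ℝ)) :=
  {γ | γ.map Prod.fst = μ ∧ γ.map Prod.snd = ν}

/-- The optimal transport cost `T_c(μ, ν)`. -/
def transportCost (c : E m → ℝ → ℝ) (μ : Measure (E m)) (ν : Measure ℝ) : ℝ :=
  sInf ((fun γ : Measure (E m × ℝ) => ∫ p, c p.1 p.2 ∂γ) '' plans μ ν)

/-- The density of `ν` with respect to Lebesgue measure. -/
def density (ν : Measure ℝ) (y : ℝ) : ℝ := (ν.rnDeriv volume y).toReal

/-- Assumptions on the congestion function `f : [0, ∞) → ℝ` (values at negative arguments are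
irrelevant). -/
structure IsCongestionFunction (f : ℝ → ℝ) : Prop where
  contDiffOn : ContDiffOn ℝ 1 f (Set.Ioi 0)
  strictConvexOn : StrictConvexOn ℝ (Set.Ici 0) f
  superlinear : Tendsto (fun t => f t / t) atTop atTop
  deriv_zero : Tendsto (deriv f) (𝓝[>] 0) atBot

open Classical in
/-- The congestion functional: `∫_Y f(ν̄(y)) dy` if `ν` is absolutely continuous, `+∞` otherwise.
A function `f` as above is bounded below, so on a bounded `Y` non-integrability of `f(ν̄)` means
that the integral is `+∞`. -/
def congestion (f : ℝ → ℝ) (Y : Set ℝ) (ν : Measure ℝ) : EReal :=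
  if ν ≪ volume ∧ IntegrableOn (fun y => f (density ν y)) Y then
    ((∫ y in Y, f (density ν y) : ℝ) : EReal)
  else ⊤

/-- Probability measures on `ℝ` concentrated on `S`. -/
def probOn (S : Set ℝ) : Set (Measure ℝ) := {ν | IsProbabilityMeasure ν ∧ ν Sᶜ = 0}

/-- `ν` minimizes `T_c(μ, ·) + ∫_Y f` over the probability measures on `closure Y`. -/
def IsMinimizer (Y : Set ℝ) (c : E m → ℝ → ℝ) (μ : Measure (E m)) (f : ℝ → ℝ)
    (ν : Measure ℝ) : Prop :=
  ν ∈ probOn (closure Y) ∧ ∀ ν' ∈ probOn (closure Y),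
    (transportCost c μ ν : EReal) + congestion f Y ν ≤
      (transportCost c μ ν' : EReal) + congestion f Y ν'

/-! ### The lower density bound -/

/-- `(f')⁻¹ : ℝ → (0, ∞)`. -/
def derivInv (f : ℝ → ℝ) : ℝ → ℝ := Function.invFunOn (deriv f) (Set.Ioi 0)

/-- `K_v`, the inverse of `z ↦ ∫_Y (f')⁻¹(z - v(y)) dy`. -/
def K (f : ℝ → ℝ) (Y : Set ℝ) (v : ℝ → ℝ) : ℝ → ℝ :=
  Function.invFun (fun z => ∫ y in Y, derivInv f (z - v y))

/-- The density bound `(f')⁻¹(K_{-M y}(1) - M y)`. -/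
def lowerBound (f : ℝ → ℝ) (Y : Set ℝ) (M y : ℝ) : ℝ :=
  derivInv f (K f Y (fun t => -(M * t)) 1 - M * y)

end Congestion

end

/-!
Since `D²_{xy} c ≠ 0`, the level sets of `∂_y c(·, y)` are null, so `μ(X_≥(y, k))` is continuous
in `k` and takes every value in `[0, 1]`; this yields `k(y)`.

Compare the density `u` of the minimizer `ν` with the profiles `l y = (f')⁻¹(κ - φ y)` and
`h y = (f')⁻¹(κ + φ y)`, where `κ` is chosen such that `h` has mass one and `φ` is such that
transporting to `y'` instead of `y` costs at most `φ y + φ y'` more; on `Y = (0, b)` this holds for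
`φ y = M_c y`. If `u` were below `l` on a set of positive measure, it would exceed `h` by at least
as much elsewhere, since `l ≤ h` and `u` and `h` have the same mass. Moving mass from `{u > h}` to
`{u < l}` then raises the transport cost by at most the integral of `φ` over the mass removed plus
that over the mass added, whereas by strict convexity of `f` the congestion term drops by more than
that. Hence `u ≥ l` almost everywhere, and `ν((y₀, y₁]) ≥ (y₁ - y₀) l(y₁)` because `l` is
decreasing. When this bound exceeds the minimal mass difference, `μ(X_≥(y₁, k(y₁)))` exceeds
`μ(X_≥(y₁, k_max))`, which forces `k(y₁) < k_max(y₀, y₁, k(y₀))`.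
-/

namespace Congestion

namespace IsCongestionFunction

variable {f : ℝ → ℝ}

lemma differentiableAt (hf : IsCongestionFunction f) {t : ℝ} (ht : 0 < t) :
    DifferentiableAt ℝ f t :=
  (hf.contDiffOn.differentiableOn one_ne_zero).differentiableAt (Ioi_mem_nhds ht)

lemma continuousOn_deriv (hf : IsCongestionFunction f) : ContinuousOn (deriv f) (Set.Ioi 0) :=
  hf.contDiffOn.continuousOn_deriv_of_isOpen isOpen_Ioi le_rfl

lemma strictMonoOn_deriv (hf : IsCongestionFunction f) : StrictMonoOn (deriv f) (Set.Ioi 0) :=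
  (hf.strictConvexOn.subset Set.Ioi_subset_Ici_self (convex_Ioi 0)).strictMonoOn_deriv
    fun _ ht => hf.differentiableAt ht

lemma tangent_lt (hf : IsCongestionFunction f) {w t : ℝ} (hw : 0 < w) (ht : 0 ≤ t) (hne : t ≠ w) :
    f w + deriv f w * (t - w) < f t := by
  rcases lt_or_gt_of_ne hne with h | h
  · have hslope := hf.strictConvexOn.slope_lt_deriv ht hw.le h (hf.differentiableAt hw)
    rw [slope_def_field, div_lt_iff₀ (by linarith)] at hslope
    linarith
  · have hslope := hf.strictConvexOn.deriv_lt_slope hw.le ht h (hf.differentiableAt hw)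
    rw [slope_def_field, lt_div_iff₀ (by linarith)] at hslope
    linarith

lemma tangent_le (hf : IsCongestionFunction f) {w t : ℝ} (hw : 0 < w) (ht : 0 ≤ t) :
    f w + deriv f w * (t - w) ≤ f t := by
  rcases eq_or_ne t w with rfl | h
  · simp
  · exact (hf.tangent_lt hw ht h).le

lemma exists_le_deriv (hf : IsCongestionFunction f) (z : ℝ) : ∃ t, 0 < t ∧ z ≤ deriv f t := by
  obtain ⟨t, hft, ht⟩ : ∃ t, |f 1| + |z| ≤ f t / t ∧ 1 < t :=
    ((hf.superlinear.eventually_ge_atTop _).and (eventually_gt_atTop 1)).exists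
  have ht0 : 0 < t := one_pos.trans ht
  refine ⟨t, ht0, le_of_mul_le_mul_right ?_ (sub_pos.2 ht)⟩
  have htangent := hf.tangent_le ht0 zero_le_one
  rw [le_div_iff₀ ht0] at hft
  have hf1 : f 1 ≤ |f 1| * t := (le_abs_self _).trans (le_mul_of_one_le_right (abs_nonneg _) ht.le)
  have hz : z * (t - 1) ≤ |z| * t :=
    mul_le_mul (le_abs_self z) (by linarith) (by linarith) (abs_nonneg z)
  linarith

lemma surjOn_deriv (hf : IsCongestionFunction f) : Set.SurjOn (deriv f) (Set.Ioi 0) Set.univ := by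
  intro z _
  obtain ⟨a, haz, ha⟩ : ∃ a, deriv f a ≤ z ∧ a ∈ Set.Ioi (0 : ℝ) :=
    ((hf.deriv_zero.eventually_le_atBot z).and self_mem_nhdsWithin).exists
  obtain ⟨b, hb, hbz⟩ := hf.exists_le_deriv z
  exact isPreconnected_Ioi.intermediate_value ha hb hf.continuousOn_deriv ⟨haz, hbz⟩

lemma derivInv_pos (hf : IsCongestionFunction f) (z : ℝ) : 0 < derivInv f z :=
  Function.invFunOn_mem (hf.surjOn_deriv (Set.mem_univ z))

lemma deriv_derivInv (hf : IsCongestionFunction f) (z : ℝ) : deriv f (derivInv f z) = z :=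
  Function.invFunOn_eq (hf.surjOn_deriv (Set.mem_univ z))

lemma derivInv_deriv (hf : IsCongestionFunction f) {t : ℝ} (ht : 0 < t) :
    derivInv f (deriv f t) = t :=
  hf.strictMonoOn_deriv.injOn (hf.derivInv_pos _) ht (hf.deriv_derivInv _)

lemma deriv_le_iff (hf : IsCongestionFunction f) {t z : ℝ} (ht : 0 < t) :
    deriv f t ≤ z ↔ t ≤ derivInv f z := by
  rw [← hf.strictMonoOn_deriv.le_iff_le ht (hf.derivInv_pos z), hf.deriv_derivInv]

lemma le_deriv_iff (hf : IsCongestionFunction f) {t z : ℝ} (ht : 0 < t) :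
    z ≤ deriv f t ↔ derivInv f z ≤ t := by
  rw [← hf.strictMonoOn_deriv.le_iff_le (hf.derivInv_pos z) ht, hf.deriv_derivInv]

lemma strictMono_derivInv (hf : IsCongestionFunction f) : StrictMono (derivInv f) :=
  fun a b hab => by
    rwa [← hf.strictMonoOn_deriv.lt_iff_lt (hf.derivInv_pos a) (hf.derivInv_pos b),
      hf.deriv_derivInv, hf.deriv_derivInv]

lemma continuous_derivInv (hf : IsCongestionFunction f) : Continuous (derivInv f) := by
  refine continuous_iff_continuousAt.2 fun z => ?_
  refine (hf.strictMono_derivInv.strictMonoOn Set.univ).continuousAt_of_image_mem_nhds univ_mem ?_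
  exact mem_of_superset (Ioi_mem_nhds (hf.derivInv_pos z)) fun t ht =>
    ⟨deriv f t, trivial, hf.derivInv_deriv ht⟩

lemma continuous_integral_derivInv_sub (hf : IsCongestionFunction f) {a b : ℝ} (hab : a ≤ b)
    {v : ℝ → ℝ} (hv : Continuous v) :
    Continuous fun z => ∫ y in Set.Ioo a b, derivInv f (z - v y) := by
  have hg := hf.continuous_derivInv
  simp only [← integral_Ioc_eq_integral_Ioo, ← intervalIntegral.integral_of_le hab]
  exact intervalIntegral.continuous_parametric_intervalIntegral_of_continuous' (by fun_prop) a b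

lemma integrableOn_derivInv_comp (hf : IsCongestionFunction f) {a b : ℝ} {w : ℝ → ℝ}
    (hw : Continuous w) : IntegrableOn (fun y => derivInv f (w y)) (Set.Ioo a b) :=
  (hf.continuous_derivInv.comp hw).integrableOn_Icc.mono_set Set.Ioo_subset_Icc_self

lemma integral_derivInv_K (hf : IsCongestionFunction f) {a b t : ℝ} (hab : a < b) (ht : 0 < t)
    {v : ℝ → ℝ} (hv : Continuous v) :
    ∫ y in Set.Ioo a b, derivInv f (K f (Set.Ioo a b) v t - v y) = t := by
  have hlen : 0 < b - a := sub_pos.2 hab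
  have hmean : derivInv f (deriv f (t / (b - a))) = t / (b - a) := hf.derivInv_deriv (by positivity)
  have hconst : ∫ _ in Set.Ioo a b, t / (b - a) = t := by
    rw [setIntegral_const, Real.volume_real_Ioo_of_le hab.le, smul_eq_mul]
    field_simp
  have hint : ∀ z, IntegrableOn (fun y => derivInv f (z - v y)) (Set.Ioo a b) := fun z =>
    hf.integrableOn_derivInv_comp (continuous_const.sub hv)
  obtain ⟨C, hC⟩ := isCompact_Icc.exists_bound_of_continuousOn (hv.continuousOn (s := Set.Icc a b))
  have hvC : ∀ y ∈ Set.Ioo a b, |v y| ≤ C := fun y hy => hC y (Set.Ioo_subset_Icc_self hy)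
  have hlow : ∫ y in Set.Ioo a b, derivInv f (deriv f (t / (b - a)) - C - v y) ≤ t := by
    refine (setIntegral_mono_on (hint _) (by simp) measurableSet_Ioo fun y hy => ?_).trans_eq hconst
    refine (hf.strictMono_derivInv.monotone ?_).trans_eq hmean
    linarith [(abs_le.1 (hvC y hy)).1]
  have hhigh : t ≤ ∫ y in Set.Ioo a b, derivInv f (deriv f (t / (b - a)) + C - v y) := by
    refine hconst.symm.trans_le
      (setIntegral_mono_on (by simp) (hint _) measurableSet_Ioo fun y hy => ?_)
    refine hmean.symm.trans_le (hf.strictMono_derivInv.monotone ?_)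
    linarith [(abs_le.1 (hvC y hy)).2]
  exact Function.invFun_eq (mem_range_of_exists_le_of_exists_ge
    (hf.continuous_integral_derivInv_sub hab.le hv) ⟨_, hlow⟩ ⟨_, hhigh⟩)

-- `f` may jump at `0`, so measurability has to be assembled from `{0}` and `(0, ∞)`.
lemma measurable_comp (hf : IsCongestionFunction f) {α : Type*} [MeasurableSpace α] {u : α → ℝ}
    (hu : Measurable u) (hu0 : ∀ a, 0 ≤ u a) : Measurable fun a => f (u a) := by
  have hpiece : Measurable ((Set.Ioi 0).piecewise f fun _ => f 0) :=
    hf.contDiffOn.continuousOn.measurable_piecewise continuousOn_const measurableSet_Ioi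
  convert hpiece.comp hu using 2 with a
  rcases (hu0 a).eq_or_lt with h | h
  · simp [← h]
  · simp [Set.piecewise, h]

lemma integrable_comp_of_le (hf : IsCongestionFunction f) {α : Type*} [MeasurableSpace α]
    {τ : Measure α} [IsFiniteMeasure τ] {u G : α → ℝ} (hu : Measurable u) (hu0 : ∀ a, 0 ≤ u a)
    (hui : Integrable u τ) (hG : Integrable G τ) (hle : ∀ᵐ a ∂τ, f (u a) ≤ G a) :
    Integrable (fun a => f (u a)) τ :=
  integrable_of_le_of_le (hf.measurable_comp hu hu0).aestronglyMeasurable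
    (ae_of_all _ fun a => hf.tangent_le one_pos (hu0 a)) hle
    ((integrable_const _).add ((hui.sub (integrable_const _)).const_mul _)) hG

lemma map_add_lt (hf : IsCongestionFunction f) {u s p : ℝ} (hu : 0 ≤ u) (hs : 0 < s)
    (hp : u + s ≤ derivInv f p) : f (u + s) < f u + s * p := by
  have hpos : 0 < u + s := by linarith
  have htangent := hf.tangent_lt hpos hu (by linarith)
  have hslope := mul_le_mul_of_nonneg_left ((hf.deriv_le_iff hpos).2 hp) hs.le
  linarith

lemma map_sub_le (hf : IsCongestionFunction f) {u r q : ℝ} (hr : 0 ≤ r)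
    (hq : derivInv f q ≤ u - r) : f (u - r) ≤ f u - r * q := by
  have hpos : 0 < u - r := (hf.derivInv_pos q).trans_le hq
  have htangent := hf.tangent_le hpos (t := u) (by linarith)
  have hslope := mul_le_mul_of_nonneg_left ((hf.le_deriv_iff hpos).2 hq) hr
  linarith

lemma map_sub_add_lt (hf : IsCongestionFunction f) {u r s p q : ℝ} (hpq : p ≤ q) (hu : 0 ≤ u)
    (hr0 : 0 ≤ r) (hr : r ≤ max (u - derivInv f q) 0)
    (hs0 : 0 < s) (hs : s ≤ max (derivInv f p - u) 0) :
    f (u - r + s) < f u + s * p - r * q := by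
  have hsu : s ≤ derivInv f p - u := (le_max_iff.1 hs).resolve_right hs0.not_ge
  have hmono := hf.strictMono_derivInv.monotone hpq
  obtain rfl : r = 0 := hr0.antisymm' (hr.trans_eq (max_eq_right (by linarith)))
  simpa using hf.map_add_lt hu hs0 (by linarith)

lemma map_sub_add_le (hf : IsCongestionFunction f) {u r s p q : ℝ} (hpq : p ≤ q) (hu : 0 ≤ u)
    (hr0 : 0 ≤ r) (hr : r ≤ max (u - derivInv f q) 0)
    (hs0 : 0 ≤ s) (hs : s ≤ max (derivInv f p - u) 0) :
    f (u - r + s) ≤ f u + s * p - r * q := by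
  rcases hs0.eq_or_lt with rfl | hs0
  · rcases hr0.eq_or_lt with rfl | hr0
    · simp
    · have hru : r ≤ u - derivInv f q := (le_max_iff.1 hr).resolve_right hr0.not_ge
      simpa using hf.map_sub_le hr0.le (by linarith)
  · exact (hf.map_sub_add_lt hpq hu hr0 hr hs0 hs).le

end IsCongestionFunction

lemma addHaar_eq_zero_of_fderiv_ne_zero {F : Type*} [NormedAddCommGroup F] [NormedSpace ℝ F]
    [FiniteDimensional ℝ F] [MeasurableSpace F] [BorelSpace F] (ρ : Measure F) [ρ.IsAddHaarMeasure]
    {g : F → ℝ} {A : Set F} {t : ℝ} (hA : ∀ x ∈ A, g x = t) (hg : ∀ x ∈ A, fderiv ℝ g x ≠ 0) :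
    ρ A = 0 := by
  have hv : ∀ x, ∃ v : F, x ∈ A → fderiv ℝ g x v = -1 := fun x => by
    by_cases hx : x ∈ A
    · obtain ⟨w, hw⟩ := ContinuousLinearMap.exists_ne_zero (hg x hx)
      exact ⟨-(fderiv ℝ g x w)⁻¹ • w, fun _ => by simp [hw]⟩
    · exact ⟨0, fun h => absurd h hx⟩
  choose v hv using hv
  -- On `A` the identity agrees with `y ↦ y + (g y - t) • v x`, whose derivative at `x` kills `v x`.
  set D : F → F →L[ℝ] F :=
    fun x => ContinuousLinearMap.id ℝ F + (fderiv ℝ g x).smulRight (v x) with hD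
  have hderiv : ∀ x ∈ A, HasFDerivWithinAt id (D x) A x := fun x hx => by
    have hdiff : DifferentiableAt ℝ g x :=
      not_imp_comm.1 fderiv_zero_of_not_differentiableAt (hg x hx)
    have hcollapse : HasFDerivWithinAt (fun x' => x' + (g x' - t) • v x) (D x) A x :=
      (hasFDerivWithinAt_id x A).add
        ((hdiff.hasFDerivAt.hasFDerivWithinAt.sub_const t).smul_const (v x))
    exact hcollapse.congr (fun x' hx' => by simp [hA x' hx']) (by simp [hA x hx])
  have hdet : ∀ x ∈ A, (D x).det = 0 := fun x hx => by
    by_contra hne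
    have hker : D x (v x) = D x 0 := by simp [hD, hv x hx]
    have hv0 : v x = 0 := (LinearMap.equivOfDetNeZero (D x : F →ₗ[ℝ] F) hne).injective hker
    simpa [hv0] using hv x hx
  simpa using addHaar_image_eq_zero_of_det_fderivWithin_eq_zero ρ hderiv hdet

lemma continuous_measure_superlevel {α : Type*} [MeasurableSpace α] {μ : Measure α}
    [IsFiniteMeasure μ] {A : Set α} {g : α → ℝ} (hmeas : ∀ k, MeasurableSet {x ∈ A | k ≤ g x})
    (hnull : ∀ k, μ {x ∈ A | g x = k} = 0) : Continuous fun k => μ {x ∈ A | k ≤ g x} := by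
  refine continuous_iff_continuousAt.2 fun k =>
    tendsto_measure_of_ae_tendsto_indicator_of_isFiniteMeasure _ (hmeas k) hmeas ?_
  filter_upwards [measure_eq_zero_iff_ae_notMem.1 (hnull k)] with x hx
  by_cases hxA : x ∈ A
  · rcases lt_or_gt_of_ne fun h : g x = k => hx ⟨hxA, h⟩ with h | h
    · filter_upwards [Ioi_mem_nhds h] with k' hk'
      exact iff_of_false (fun hxk => hk'.not_ge hxk.2) fun hxk => h.not_ge hxk.2
    · filter_upwards [Iio_mem_nhds h] with k' hk'
      exact iff_of_true ⟨hxA, le_of_lt hk'⟩ ⟨hxA, h.le⟩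
  · exact Eventually.of_forall fun k' => iff_of_false (fun h => hxA h.1) fun h => hxA h.1

lemma IsC2OnClosure.exists_fderiv_bound {F : Type*} [NormedAddCommGroup F] [NormedSpace ℝ F]
    {Ω : Set F} {g : F → ℝ} (hg : IsC2OnClosure Ω g) (hΩ : IsCompact (closure Ω)) :
    ∃ C, ∀ p ∈ Ω, ‖fderiv ℝ g p‖ ≤ C := by
  obtain ⟨G, hG, hGg⟩ := hg.extend 1 one_le_two
  obtain ⟨C, hC⟩ := hΩ.exists_bound_of_continuousOn hG
  refine ⟨C, fun p hp => ?_⟩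
  rw [← norm_iteratedFDeriv_one, ← hGg hp]
  exact hC p (subset_closure hp)

section Cost

variable {m : ℕ} {X : Set (E m)} {Y : Set ℝ} {c : E m → ℝ → ℝ} {x : E m} {y : ℝ}

lemma hasDerivAt_of_differentiableAt_uncurry
    (hc : DifferentiableAt ℝ (Function.uncurry c) (x, y)) :
    HasDerivAt (c x) (fderiv ℝ (Function.uncurry c) (x, y) (0, 1)) y :=
  hc.hasFDerivAt.comp_hasDerivAt y ((hasDerivAt_const y x).prodMk (hasDerivAt_id y))

lemma dy_eq_fderiv (hc : DifferentiableAt ℝ (Function.uncurry c) (x, y)) :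
    dy c x y = fderiv ℝ (Function.uncurry c) (x, y) (0, 1) :=
  (hasDerivAt_of_differentiableAt_uncurry hc).deriv

lemma differentiableAt_uncurry (hXo : IsOpen X) (hYo : IsOpen Y)
    (hc : DifferentiableOn ℝ (Function.uncurry c) (X ×ˢ Y)) (hx : x ∈ X) (hy : y ∈ Y) :
    DifferentiableAt ℝ (Function.uncurry c) (x, y) :=
  hc.differentiableAt ((hXo.prod hYo).mem_nhds ⟨hx, hy⟩)

lemma continuousOn_dy (hXo : IsOpen X) (hYo : IsOpen Y)
    (hc : ContDiffOn ℝ 1 (Function.uncurry c) (X ×ˢ Y)) (hy : y ∈ Y) :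
    ContinuousOn (fun x => dy c x y) X := by
  have hpartial : ContinuousOn (fun x => fderiv ℝ (Function.uncurry c) (x, y) (0, 1)) X :=
    ((hc.continuousOn_fderiv_of_isOpen (hXo.prod hYo) le_rfl).comp (f := fun x => (x, y))
      (by fun_prop) fun x hx => ⟨hx, hy⟩).clm_apply continuousOn_const
  exact hpartial.congr fun x hx =>
    dy_eq_fderiv (differentiableAt_uncurry hXo hYo (hc.differentiableOn one_ne_zero) hx hy)

lemma measurableSet_superGE (hXo : IsOpen X) (hYo : IsOpen Y)
    (hc : ContDiffOn ℝ 1 (Function.uncurry c) (X ×ˢ Y)) (hy : y ∈ Y) (k : ℝ) :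
    MeasurableSet (superGE X c y k) := by
  obtain ⟨S, hS, hSX⟩ :=
    continuousOn_iff_isClosed.1 (continuousOn_dy hXo hYo hc hy) (Set.Ici k) isClosed_Ici
  rw [show superGE X c y k = (fun x => dy c x y) ⁻¹' Set.Ici k ∩ X from Set.inter_comm _ _, hSX]
  exact hS.measurableSet.inter hXo.measurableSet

lemma continuousOn_mixed (hXo : IsOpen X) (hYo : IsOpen Y)
    (hc : ContDiffOn ℝ 2 (Function.uncurry c) (X ×ˢ Y)) :
    ContinuousOn (mixed c) (X ×ˢ Y) := by
  have hO : IsOpen (X ×ˢ Y) := hXo.prod hYo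
  set g : E m × ℝ → ℝ := fun q => fderiv ℝ (Function.uncurry c) q (0, 1)
  have hg : ContDiffOn ℝ 1 g (X ×ˢ Y) :=
    (hc.fderiv_of_isOpen hO (m := 1) (by norm_num)).clm_apply contDiffOn_const
  have hpartial : ContinuousOn
      (fun p => (fderiv ℝ g p).comp (ContinuousLinearMap.inl ℝ (E m) ℝ)) (X ×ˢ Y) :=
    (hg.continuousOn_fderiv_of_isOpen hO le_rfl).clm_comp continuousOn_const
  refine hpartial.congr ?_
  rintro ⟨x, y⟩ hp
  have hgp : HasFDerivAt g (fderiv ℝ g (x, y)) (x, y) :=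
    ((hg.differentiableOn one_ne_zero).differentiableAt (hO.mem_nhds hp)).hasFDerivAt
  have hgx : HasFDerivAt (fun x' => g (x', y))
      ((fderiv ℝ g (x, y)).comp (ContinuousLinearMap.inl ℝ (E m) ℝ)) x :=
    hgp.comp (f := fun x' => (x', y)) x (hasFDerivAt_prodMk_left x y)
  refine (hgx.congr_of_eventuallyEq ?_).fderiv
  filter_upwards [hXo.mem_nhds hp.1] with x' hx'
  exact dy_eq_fderiv
    (differentiableAt_uncurry hXo hYo (hc.differentiableOn two_ne_zero) hx' hp.2)

lemma Nondegenerate.mixed_ne_zero (hnondeg : Nondegenerate X Y c) (hXo : IsOpen X) (hYo : IsOpen Y)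
    (hc : ContDiffOn ℝ 2 (Function.uncurry c) (X ×ˢ Y)) {p : E m × ℝ} (hp : p ∈ X ×ˢ Y) :
    mixed c p ≠ 0 := by
  rw [← extendFrom_eq (subset_closure hp) (continuousOn_mixed hXo hYo hc p hp)]
  exact hnondeg p ⟨subset_closure hp.1, subset_closure hp.2⟩

lemma exists_dy_bound (hXo : IsOpen X) (hXb : Bornology.IsBounded X) (hYo : IsOpen Y)
    (hYb : Bornology.IsBounded Y) (hc : IsC2OnClosure (X ×ˢ Y) (Function.uncurry c)) :
    ∃ C, ∀ x ∈ X, ∀ y ∈ Y, |dy c x y| ≤ C := by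
  obtain ⟨C, hC⟩ := hc.exists_fderiv_bound (hXb.prod hYb).isCompact_closure
  refine ⟨C, fun x hx y hy => ?_⟩
  rw [dy_eq_fderiv (differentiableAt_uncurry hXo hYo
    (hc.contDiffOn.differentiableOn two_ne_zero) hx hy), ← Real.norm_eq_abs]
  refine (ContinuousLinearMap.le_opNorm_of_le _ (c := 1) ?_).trans ?_
  · simp [Prod.norm_def]
  · simpa using hC (x, y) ⟨hx, hy⟩

lemma exists_lipschitz_bound_closure (hXo : IsOpen X) (hXb : Bornology.IsBounded X)
    (hYo : IsOpen Y) (hYb : Bornology.IsBounded Y) (hYc : Convex ℝ Y)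
    (hc : IsC2OnClosure (X ×ˢ Y) (Function.uncurry c)) :
    ∃ C, ∀ x ∈ closure X, ∀ y₀ ∈ closure Y, ∀ y₁ ∈ closure Y,
      |c x y₀ - c x y₁| ≤ C * |y₀ - y₁| := by
  obtain ⟨C, hC⟩ := exists_dy_bound hXo hXb hYo hYb hc
  have hinterior : ∀ q ∈ X ×ˢ Y ×ˢ Y, |c q.1 q.2.1 - c q.1 q.2.2| ≤ C * |q.2.1 - q.2.2| :=
    fun q hq => hYc.norm_image_sub_le_of_norm_deriv_le
      (fun y hy => (hasDerivAt_of_differentiableAt_uncurry (differentiableAt_uncurry hXo hYo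
        (hc.contDiffOn.differentiableOn two_ne_zero) hq.1 hy)).differentiableAt)
      (fun y hy => hC q.1 hq.1 y hy) hq.2.2 hq.2.1
  have hcl : closure (X ×ˢ Y ×ˢ Y) = closure X ×ˢ closure Y ×ˢ closure Y := by
    rw [closure_prod_eq, closure_prod_eq]
  have hcont := hc.continuousOn
  rw [closure_prod_eq] at hcont
  have hcont₀ : ContinuousOn (fun q : E m × ℝ × ℝ => c q.1 q.2.1) (closure (X ×ˢ Y ×ˢ Y)) :=
    hcont.comp (f := fun q : E m × ℝ × ℝ => (q.1, q.2.1)) (by fun_prop)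
      fun q hq => ⟨(hcl ▸ hq).1, (hcl ▸ hq).2.1⟩
  have hcont₁ : ContinuousOn (fun q : E m × ℝ × ℝ => c q.1 q.2.2) (closure (X ×ˢ Y ×ˢ Y)) :=
    hcont.comp (f := fun q : E m × ℝ × ℝ => (q.1, q.2.2)) (by fun_prop)
      fun q hq => ⟨(hcl ▸ hq).1, (hcl ▸ hq).2.2⟩
  exact ⟨C, fun x hx y₀ h₀ y₁ h₁ =>
    le_on_closure (x := (x, y₀, y₁)) hinterior (hcont₀.sub hcont₁).abs (by fun_prop)
      (by rw [hcl]; exact ⟨hx, h₀, h₁⟩)⟩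

lemma abs_sub_le_lipConst_mul (hXo : IsOpen X) (hXb : Bornology.IsBounded X)
    (hYo : IsOpen Y) (hYb : Bornology.IsBounded Y) (hYc : Convex ℝ Y)
    (hc : IsC2OnClosure (X ×ˢ Y) (Function.uncurry c)) (hx : x ∈ closure X) {y₀ y₁ : ℝ}
    (h₀ : y₀ ∈ closure Y) (h₁ : y₁ ∈ closure Y) :
    |c x y₀ - c x y₁| ≤ lipConst X Y c * |y₀ - y₁| := by
  obtain ⟨C, hC⟩ := exists_lipschitz_bound_closure hXo hXb hYo hYb hYc hc
  rcases eq_or_ne y₀ y₁ with rfl | hne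
  · simp
  rw [← div_le_iff₀ (abs_sub_pos.2 hne)]
  refine le_csSup ⟨max C 0, ?_⟩ ⟨x, hx, y₀, h₀, y₁, h₁, rfl⟩
  rintro _ ⟨x, hx, y₀, h₀, y₁, h₁, rfl⟩
  refine div_le_of_le_mul₀ (abs_nonneg _) (le_max_right _ _) ((hC x hx y₀ h₀ y₁ h₁).trans ?_)
  gcongr
  exact le_max_left _ _

lemma lipConst_nonneg : 0 ≤ lipConst X Y c := by
  refine Real.sSup_nonneg ?_
  rintro _ ⟨x, -, y₀, -, y₁, -, rfl⟩
  positivity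

lemma exists_measure_superGE_eq (hXo : IsOpen X) (hXb : Bornology.IsBounded X) (hYo : IsOpen Y)
    (hYb : Bornology.IsBounded Y) (hc : IsC2OnClosure (X ×ˢ Y) (Function.uncurry c))
    (hmixed : ∀ p ∈ X ×ˢ Y, mixed c p ≠ 0) {μ : Measure (E m)} [IsFiniteMeasure μ]
    (hμ : μ ≪ volume) (hy : y ∈ Y) {t : ENNReal} (ht : t ≤ μ X) :
    ∃ k, μ (superGE X c y k) = t := by
  obtain ⟨C, hC⟩ := exists_dy_bound hXo hXb hYo hYb hc
  have hcont : Continuous fun k => μ (superGE X c y k) :=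
    continuous_measure_superlevel
      (measurableSet_superGE hXo hYo (hc.contDiffOn.of_le one_le_two) hy) fun k =>
        hμ (addHaar_eq_zero_of_fderiv_ne_zero volume (g := fun x => dy c x y) (fun x hx => hx.2)
          fun x hx => hmixed (x, y) ⟨hx.1, hy⟩)
  have hempty : superGE X c y (C + 1) = ∅ := Set.eq_empty_of_forall_notMem fun x hx => by
    linarith [hx.2, (abs_le.1 (hC x hx.1 y hy)).2]
  have hfull : superGE X c y (-C) = X :=
    Set.sep_eq_self_iff_mem_true.2 fun x hx => (abs_le.1 (hC x hx y hy)).1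
  exact mem_range_of_exists_le_of_exists_ge hcont ⟨C + 1, by simp [hempty]⟩ ⟨-C, by rwa [hfull]⟩

lemma exists_isSplitting (hXo : IsOpen X) (hXb : Bornology.IsBounded X) (hYo : IsOpen Y)
    (hYb : Bornology.IsBounded Y) (hc : IsC2OnClosure (X ×ˢ Y) (Function.uncurry c))
    (hmixed : ∀ p ∈ X ×ˢ Y, mixed c p ≠ 0) {μ : Measure (E m)} [IsFiniteMeasure μ]
    (hμ : μ ≪ volume) {ν : Measure ℝ} (hν : ν Set.univ ≤ μ X) :
    ∃ k, IsSplitting X Y c μ ν k := by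
  have hlevel : ∀ y, ∃ k, y ∈ Y → μ (superGE X c y k) = ν (Set.Iic y) := fun y => by
    by_cases hy : y ∈ Y
    · obtain ⟨k, hk⟩ := exists_measure_superGE_eq hXo hXb hYo hYb hc hmixed hμ hy
        ((measure_mono (Set.subset_univ (Set.Iic y))).trans hν)
      exact ⟨k, fun _ => hk⟩
    · exact ⟨0, fun h => absurd h hy⟩
  choose k hk using hlevel
  exact ⟨k, hk⟩

end Cost

section Reroute

variable {α β : Type*} [MeasurableSpace α] [MeasurableSpace β]

lemma map_withDensity_comp (γ : Measure α) {g : α → β} (hg : Measurable g) {w : β → ENNReal}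
    (hw : Measurable w) : (γ.withDensity (w ∘ g)).map g = (γ.map g).withDensity w := by
  ext s hs
  rw [Measure.map_apply hg hs, withDensity_apply _ (hg hs), withDensity_apply _ hs,
    setLIntegral_map hs hw hg]
  rfl

lemma exists_add_eq_of_map_eq_add {γ : Measure α} {g : α → β} (hg : Measurable g)
    {ν ρ : Measure β} [IsFiniteMeasure ν] [IsFiniteMeasure ρ] (hγ : γ.map g = ν + ρ) :
    ∃ γ₀ γ₁, γ₀ + γ₁ = γ ∧ γ₀.map g = ν ∧ γ₁.map g = ρ := by
  have hν : ν ≪ ν + ρ := Measure.absolutelyContinuous_of_le (Measure.le_add_right le_rfl)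
  have hρ : ρ ≪ ν + ρ := Measure.absolutelyContinuous_of_le (Measure.le_add_left le_rfl)
  have hone : ν.rnDeriv (ν + ρ) + ρ.rnDeriv (ν + ρ) =ᵐ[γ.map g] 1 := by
    rw [hγ]
    exact (Measure.rnDeriv_add' ν ρ (ν + ρ)).symm.trans (Measure.rnDeriv_self (ν + ρ))
  refine ⟨γ.withDensity (ν.rnDeriv (ν + ρ) ∘ g), γ.withDensity (ρ.rnDeriv (ν + ρ) ∘ g), ?_, ?_, ?_⟩
  · rw [← withDensity_add_left ((Measure.measurable_rnDeriv _ _).comp hg)]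
    exact (withDensity_congr_ae (ae_of_ae_map hg.aemeasurable hone)).trans withDensity_one
  · rw [map_withDensity_comp γ hg (Measure.measurable_rnDeriv _ _), hγ,
      Measure.withDensity_rnDeriv_eq _ _ hν]
  · rw [map_withDensity_comp γ hg (Measure.measurable_rnDeriv _ _), hγ,
      Measure.withDensity_rnDeriv_eq _ _ hρ]

/-- The plan obtained from `γ₀ + γ₁` by keeping `γ₀` and sending the mass of `γ₁` to `σ` instead,
through the independent coupling. -/
noncomputable def reroute (γ₀ γ₁ : Measure (α × β)) (σ : Measure β) : Measure (α × β) :=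
  γ₀ + (γ₁ Set.univ)⁻¹ • (γ₁.map Prod.fst).prod σ

variable {γ₀ γ₁ : Measure (α × β)} {σ : Measure β}

lemma map_fst_reroute [IsFiniteMeasure γ₁] [NeZero γ₁] [SFinite σ]
    (hσ : σ Set.univ = γ₁ Set.univ) :
    (reroute γ₀ γ₁ σ).map Prod.fst = (γ₀ + γ₁).map Prod.fst := by
  rw [reroute, Measure.map_add _ _ measurable_fst, Measure.map_add _ _ measurable_fst,
    Measure.map_smul, Measure.map_fst_prod, hσ, smul_smul,
    ENNReal.inv_mul_cancel (NeZero.ne _) (measure_ne_top _ _), one_smul]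

lemma map_snd_reroute [IsFiniteMeasure γ₁] [NeZero γ₁] [SFinite σ] :
    (reroute γ₀ γ₁ σ).map Prod.snd = γ₀.map Prod.snd + σ := by
  rw [reroute, Measure.map_add _ _ measurable_snd, Measure.map_smul, Measure.map_snd_prod,
    Measure.map_apply measurable_fst MeasurableSet.univ, Set.preimage_univ, smul_smul,
    ENNReal.inv_mul_cancel (NeZero.ne _) (measure_ne_top _ _), one_smul]

lemma integral_map_fst_prod_le [IsFiniteMeasure γ₁] [IsFiniteMeasure σ]
    (hσ : σ Set.univ = γ₁ Set.univ) {c : α → β → ℝ} {φ : β → ℝ}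
    (hc : Integrable (Function.uncurry c) γ₁)
    (hcσ : Integrable (Function.uncurry c) ((γ₁.map Prod.fst).prod σ))
    (hφ : Integrable φ (γ₁.map Prod.snd)) (hφσ : Integrable φ σ)
    (hle : ∀ᵐ q ∂γ₁.prod σ, c q.1.1 q.2 ≤ c q.1.1 q.1.2 + φ q.1.2 + φ q.2) :
    ∫ p, Function.uncurry c p ∂((γ₁.map Prod.fst).prod σ) ≤
      γ₁.real Set.univ *
        (∫ p, Function.uncurry c p ∂γ₁ + ∫ y, φ y ∂(γ₁.map Prod.snd) + ∫ y, φ y ∂σ) := by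
  have hproj : MeasurePreserving (Prod.map Prod.fst id) (γ₁.prod σ) ((γ₁.map Prod.fst).prod σ) :=
    (measurable_fst.measurePreserving γ₁).prod (MeasurePreserving.id σ)
  have hφ' : Integrable (fun p : α × β => φ p.2) γ₁ := hφ.comp_measurable measurable_snd
  have hold : Integrable (fun q : (α × β) × β => Function.uncurry c q.1 + φ q.1.2) (γ₁.prod σ) :=
    (hc.add hφ').comp_fst σ
  have hnew : Integrable (fun q : (α × β) × β => φ q.2) (γ₁.prod σ) := hφσ.comp_snd γ₁
  have hmass : σ.real Set.univ = γ₁.real Set.univ := congrArg ENNReal.toReal hσ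
  calc ∫ p, Function.uncurry c p ∂((γ₁.map Prod.fst).prod σ)
      = ∫ q, c q.1.1 q.2 ∂γ₁.prod σ := by
        rw [← hproj.map_eq, integral_map hproj.aemeasurable
          (by rw [hproj.map_eq]; exact hcσ.aestronglyMeasurable)]
        rfl
    _ ≤ ∫ q, ((Function.uncurry c q.1 + φ q.1.2) + φ q.2) ∂γ₁.prod σ :=
        integral_mono_ae (hproj.integrable_comp_of_integrable hcσ) (hold.add hnew) hle
    _ = γ₁.real Set.univ *
        (∫ p, Function.uncurry c p ∂γ₁ + ∫ y, φ y ∂(γ₁.map Prod.snd) + ∫ y, φ y ∂σ) := by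
        rw [integral_add hold hnew,
          integral_fun_fst (fun p : α × β => Function.uncurry c p + φ p.2), integral_fun_snd,
          integral_add hc hφ', hmass, integral_map measurable_snd.aemeasurable
          hφ.aestronglyMeasurable]
        simp only [smul_eq_mul]
        ring

lemma integral_reroute_le [IsFiniteMeasure γ₁] [NeZero γ₁] [IsFiniteMeasure σ]
    (hσ : σ Set.univ = γ₁ Set.univ) {c : α → β → ℝ} {φ : β → ℝ}
    (hc₀ : Integrable (Function.uncurry c) γ₀) (hc₁ : Integrable (Function.uncurry c) γ₁)
    (hcσ : Integrable (Function.uncurry c) ((γ₁.map Prod.fst).prod σ))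
    (hφ : Integrable φ (γ₁.map Prod.snd)) (hφσ : Integrable φ σ)
    (hle : ∀ᵐ q ∂γ₁.prod σ, c q.1.1 q.2 ≤ c q.1.1 q.1.2 + φ q.1.2 + φ q.2) :
    ∫ p, Function.uncurry c p ∂(reroute γ₀ γ₁ σ) ≤
      ∫ p, Function.uncurry c p ∂(γ₀ + γ₁) + ∫ y, φ y ∂(γ₁.map Prod.snd) + ∫ y, φ y ∂σ := by
  have hpos : 0 < γ₁.real Set.univ := measureReal_univ_pos
  have hmoved := integral_map_fst_prod_le hσ hc₁ hcσ hφ hφσ hle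
  rw [← inv_mul_le_iff₀ hpos, measureReal_def, ← ENNReal.toReal_inv] at hmoved
  rw [reroute, integral_add_measure hc₀ (hcσ.smul_measure
      (ENNReal.inv_ne_top.2 (NeZero.ne _))), integral_smul_measure,
    integral_add_measure hc₀ hc₁, smul_eq_mul]
  linarith

end Reroute

section Transport

variable {m : ℕ} {X : Set (E m)} {Y : Set ℝ} {c : E m → ℝ → ℝ} {C : ℝ} {μ : Measure (E m)}

lemma isProbabilityMeasure_of_mem_plans [IsProbabilityMeasure μ] {ν : Measure ℝ}
    {γ : Measure (E m × ℝ)} (hγ : γ ∈ plans μ ν) : IsProbabilityMeasure γ := by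
  have hmap : IsProbabilityMeasure (γ.map Prod.fst) := by rwa [hγ.1]
  exact Measure.isProbabilityMeasure_of_map Prod.fst

lemma ae_mem_prod_of_map {α β : Type*} [MeasurableSpace α] [MeasurableSpace β]
    {γ : Measure (α × β)} {A : Set α} {B : Set β} (hA : ∀ᵐ x ∂(γ.map Prod.fst), x ∈ A)
    (hB : ∀ᵐ y ∂(γ.map Prod.snd), y ∈ B) : ∀ᵐ p ∂γ, p ∈ A ×ˢ B :=
  (ae_of_ae_map measurable_fst.aemeasurable hA).and (ae_of_ae_map measurable_snd.aemeasurable hB)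

lemma integrable_of_continuousOn_of_bound {α : Type*} [TopologicalSpace α] [MeasurableSpace α]
    [BorelSpace α] {γ : Measure α} [IsFiniteMeasure γ] {S : Set α} (hS : MeasurableSet S)
    {g : α → ℝ} (hg : ContinuousOn g S) (hC : ∀ p ∈ S, |g p| ≤ C) (hγ : ∀ᵐ p ∂γ, p ∈ S) :
    Integrable g γ :=
  Integrable.of_bound (Measure.restrict_eq_self_of_ae_mem hγ ▸ hg.aestronglyMeasurable hS) C
    (hγ.mono hC)

lemma transportCost_le_integral [IsProbabilityMeasure μ] (hX : MeasurableSet X)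
    (hY : MeasurableSet Y) (hc : ContinuousOn (Function.uncurry c) (X ×ˢ Y))
    (hC : ∀ p ∈ X ×ˢ Y, |Function.uncurry c p| ≤ C) (hμX : ∀ᵐ x ∂μ, x ∈ X) {ν : Measure ℝ}
    (hνY : ∀ᵐ y ∂ν, y ∈ Y) {γ : Measure (E m × ℝ)} (hγ : γ ∈ plans μ ν) :
    transportCost c μ ν ≤ ∫ p, Function.uncurry c p ∂γ := by
  refine csInf_le ⟨-C, ?_⟩ ⟨γ, hγ, rfl⟩
  rintro _ ⟨γ, hγ, rfl⟩
  have hprob := isProbabilityMeasure_of_mem_plans hγ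
  have hconc := ae_mem_prod_of_map (hγ.1 ▸ hμX) (hγ.2 ▸ hνY)
  calc -C = ∫ _, -C ∂γ := by simp
    _ ≤ ∫ p, Function.uncurry c p ∂γ := integral_mono_ae (integrable_const _)
        (integrable_of_continuousOn_of_bound (hX.prod hY) hc hC hconc)
        (hconc.mono fun p hp => (abs_le.1 (hC p hp)).1)

lemma transportCost_add_le [IsProbabilityMeasure μ] (hX : MeasurableSet X)
    (hY : MeasurableSet Y) (hc : ContinuousOn (Function.uncurry c) (X ×ˢ Y))
    (hC : ∀ p ∈ X ×ˢ Y, |Function.uncurry c p| ≤ C) {φ : ℝ → ℝ}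
    (hφ : ∀ x ∈ X, ∀ y ∈ Y, ∀ y' ∈ Y, c x y' ≤ c x y + φ y + φ y') (hμX : ∀ᵐ x ∂μ, x ∈ X)
    {ν ρ σ : Measure ℝ} [IsFiniteMeasure ρ] [IsFiniteMeasure σ] [IsProbabilityMeasure (ν + ρ)]
    (hνY : ∀ᵐ y ∂ν, y ∈ Y) (hρY : ∀ᵐ y ∂ρ, y ∈ Y) (hσY : ∀ᵐ y ∂σ, y ∈ Y)
    (hσρ : σ Set.univ = ρ Set.univ) (hφρ : Integrable φ ρ) (hφσ : Integrable φ σ) :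
    transportCost c μ (ν + σ) ≤ transportCost c μ (ν + ρ) + ∫ y, φ y ∂ρ + ∫ y, φ y ∂σ := by
  rcases eq_zero_or_neZero ρ with rfl | hρ0
  · obtain rfl : σ = 0 := Measure.measure_univ_eq_zero.1 (by simpa using hσρ)
    simp
  have hν : IsFiniteMeasure ν := isFiniteMeasure_of_le (ν + ρ) (Measure.le_add_right le_rfl)
  have hint : ∀ {γ : Measure (E m × ℝ)} [IsFiniteMeasure γ], (∀ᵐ p ∂γ, p ∈ X ×ˢ Y) →
      Integrable (Function.uncurry c) γ := integrable_of_continuousOn_of_bound (hX.prod hY) hc hC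
  have hνρY : ∀ᵐ y ∂(ν + ρ), y ∈ Y := ae_add_measure_iff.2 ⟨hνY, hρY⟩
  rw [add_assoc, ← sub_le_iff_le_add]
  refine le_csInf ⟨_, μ.prod (ν + ρ), ⟨by simp, by simp⟩, rfl⟩ ?_
  rintro _ ⟨γ, hγ, rfl⟩
  have hprob := isProbabilityMeasure_of_mem_plans hγ
  obtain ⟨γ₀, γ₁, hsum, hγ₀, rfl⟩ := exists_add_eq_of_map_eq_add measurable_snd hγ.2
  have hconc := ae_mem_prod_of_map (hγ.1 ▸ hμX) (hγ.2 ▸ hνρY)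
  rw [← hsum, ae_add_measure_iff] at hconc
  have hfin₀ : IsFiniteMeasure γ₀ := isFiniteMeasure_of_le γ (hsum ▸ Measure.le_add_right le_rfl)
  have hfin₁ : IsFiniteMeasure γ₁ := isFiniteMeasure_of_le γ (hsum ▸ Measure.le_add_left le_rfl)
  have hγ₁0 : NeZero γ₁ := ⟨by rintro rfl; exact hρ0.ne _ (Measure.map_zero _)⟩
  have hmass : σ Set.univ = γ₁ Set.univ := by
    rw [hσρ, Measure.map_apply measurable_snd MeasurableSet.univ, Set.preimage_univ]
  have hplan : reroute γ₀ γ₁ σ ∈ plans μ (ν + σ) :=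
    ⟨by rw [map_fst_reroute hmass, hsum, hγ.1], by rw [map_snd_reroute, hγ₀]⟩
  have hprod : ∀ᵐ q ∂γ₁.prod σ, q.1 ∈ X ×ˢ Y ∧ q.2 ∈ Y :=
    (Measure.quasiMeasurePreserving_fst.ae hconc.2).and (Measure.quasiMeasurePreserving_snd.ae hσY)
  have hcσ : ∀ᵐ p ∂(γ₁.map Prod.fst).prod σ, p ∈ X ×ˢ Y :=
    (Measure.quasiMeasurePreserving_fst.ae ((ae_map_iff measurable_fst.aemeasurable hX).2
      (hconc.2.mono fun _ hp => hp.1))).and (Measure.quasiMeasurePreserving_snd.ae hσY)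
  have hcost := integral_reroute_le (γ₀ := γ₀) hmass (hint hconc.1) (hint hconc.2) (hint hcσ)
    hφρ hφσ (hprod.mono fun q hq => hφ _ hq.1.1 _ hq.1.2 _ hq.2)
  rw [hsum] at hcost
  rw [sub_le_iff_le_add, ← add_assoc]
  exact (transportCost_le_integral hX hY hc hC hμX (ae_add_measure_iff.2 ⟨hνY, hσY⟩) hplan).trans
    hcost

end Transport

section Density

/-- The measure on `Y` with density `u` with respect to Lebesgue measure (negative values of `u`
count as `0`). -/
noncomputable def ofDensity (Y : Set ℝ) (u : ℝ → ℝ) : Measure ℝ :=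
  (volume.restrict Y).withDensity fun y => ENNReal.ofReal (u y)

variable {Y : Set ℝ} {u v φ : ℝ → ℝ} {ν : Measure ℝ}

lemma measurable_density (ν : Measure ℝ) : Measurable (density ν) :=
  (Measure.measurable_rnDeriv _ _).ennreal_toReal

lemma density_nonneg (ν : Measure ℝ) (y : ℝ) : 0 ≤ density ν y := ENNReal.toReal_nonneg

lemma setIntegral_density [SigmaFinite ν] (hν : ν ≪ volume) (s : Set ℝ) :
    ∫ y in s, density ν y = ν.real s :=
  Measure.setIntegral_toReal_rnDeriv hν s

lemma integrable_density [IsFiniteMeasure ν] : Integrable (density ν) :=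
  Measure.integrable_toReal_rnDeriv

lemma setIntegral_density_eq_one [IsProbabilityMeasure ν] (hν : ν ≪ volume) (hY : MeasurableSet Y)
    (hνY : ∀ᵐ y ∂ν, y ∈ Y) : ∫ y in Y, density ν y = 1 := by
  rw [setIntegral_density hν, measureReal_def, (mem_ae_iff_prob_eq_one hY).1 hνY,
    ENNReal.toReal_one]

lemma ofDensity_density [SigmaFinite ν] (hν : ν ≪ volume) (hY : MeasurableSet Y)
    (hνY : ∀ᵐ y ∂ν, y ∈ Y) : ofDensity Y (density ν) = ν := by
  have hofReal : (fun y => ENNReal.ofReal (density ν y)) =ᵐ[volume] ν.rnDeriv volume := by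
    filter_upwards [Measure.rnDeriv_lt_top ν volume] with y hy
    exact ENNReal.ofReal_toReal hy.ne
  rw [ofDensity, ← restrict_withDensity hY, withDensity_congr_ae hofReal,
    Measure.withDensity_rnDeriv_eq _ _ hν, Measure.restrict_eq_self_of_ae_mem hνY]

lemma density_ofDensity (hY : MeasurableSet Y) (hu : Measurable u) (hu0 : ∀ y, 0 ≤ u y) :
    density (ofDensity Y u) =ᵐ[volume.restrict Y] u := by
  rw [ofDensity, ← withDensity_indicator hY]
  filter_upwards [ae_restrict_of_ae
    (Measure.rnDeriv_withDensity volume (hu.ennreal_ofReal.indicator hY)), ae_restrict_mem hY]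
    with y hy hyY
  rw [density, hy, Set.indicator_of_mem hyY, ENNReal.toReal_ofReal (hu0 y)]

lemma ofDensity_add (hu : Measurable u) (hu0 : ∀ y, 0 ≤ u y) (hv0 : ∀ y, 0 ≤ v y) :
    ofDensity Y (fun y => u y + v y) = ofDensity Y u + ofDensity Y v := by
  rw [ofDensity, ofDensity, ofDensity, ← withDensity_add_left hu.ennreal_ofReal]
  congr 1 with y
  exact ENNReal.ofReal_add (hu0 y) (hv0 y)

lemma ofDensity_absolutelyContinuous : ofDensity Y u ≪ volume :=
  (withDensity_absolutelyContinuous _ _).trans Measure.absolutelyContinuous_restrict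

lemma ae_mem_ofDensity (hY : MeasurableSet Y) : ∀ᵐ y ∂ofDensity Y u, y ∈ Y :=
  (withDensity_absolutelyContinuous _ _).ae_le (ae_restrict_mem hY)

lemma ofDensity_univ (hu : IntegrableOn u Y) (hu0 : ∀ y, 0 ≤ u y) :
    ofDensity Y u Set.univ = ENNReal.ofReal (∫ y in Y, u y) := by
  rw [ofDensity, withDensity_apply _ MeasurableSet.univ, Measure.restrict_univ,
    ofReal_integral_eq_lintegral_ofReal hu (ae_of_all _ hu0)]

lemma isFiniteMeasure_ofDensity (hu : IntegrableOn u Y) : IsFiniteMeasure (ofDensity Y u) :=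
  isFiniteMeasure_withDensity_ofReal hu.2

lemma integrable_ofDensity_iff (hu : Measurable u) (hu0 : ∀ y, 0 ≤ u y) :
    Integrable φ (ofDensity Y u) ↔ IntegrableOn (fun y => u y * φ y) Y := by
  rw [ofDensity, integrable_withDensity_iff_integrable_smul' hu.ennreal_ofReal (by simp)]
  simp only [ENNReal.toReal_ofReal (hu0 _), smul_eq_mul, IntegrableOn]

lemma integral_ofDensity (hu : Measurable u) (hu0 : ∀ y, 0 ≤ u y) :
    ∫ y, φ y ∂ofDensity Y u = ∫ y in Y, u y * φ y := by
  rw [ofDensity, integral_withDensity_eq_integral_toReal_smul hu.ennreal_ofReal (by simp)]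
  simp only [ENNReal.toReal_ofReal (hu0 _), smul_eq_mul]

lemma ofDensity_mem_probOn_closure (hY : MeasurableSet Y) (hu : IntegrableOn u Y)
    (hu0 : ∀ y, 0 ≤ u y) (hu1 : ∫ y in Y, u y = 1) : ofDensity Y u ∈ probOn (closure Y) :=
  ⟨⟨by rw [ofDensity_univ hu hu0, hu1, ENNReal.ofReal_one]⟩,
    (ae_mem_ofDensity hY).mono fun _ hy => subset_closure hy⟩

lemma congestion_ofDensity {f : ℝ → ℝ} (hY : MeasurableSet Y) (hu : Measurable u)
    (hu0 : ∀ y, 0 ≤ u y) (hfu : IntegrableOn (fun y => f (u y)) Y) :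
    congestion f Y (ofDensity Y u) = ((∫ y in Y, f (u y) : ℝ) : EReal) := by
  have hae : (fun y => f (density (ofDensity Y u) y)) =ᵐ[volume.restrict Y] fun y => f (u y) :=
    (density_ofDensity hY hu hu0).fun_comp f
  rw [congestion, if_pos ⟨ofDensity_absolutelyContinuous, hfu.congr hae.symm⟩,
    integral_congr_ae hae]

lemma integral_posPart_sub_le {α : Type*} [MeasurableSpace α] {τ : Measure α} {l h u : α → ℝ}
    (hl : Integrable l τ) (hh : Integrable h τ) (hu : Integrable u τ) (hlh : l ≤ᵐ[τ] h)
    (huh : ∫ y, u y ∂τ = ∫ y, h y ∂τ) :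
    ∫ y, max (l y - u y) 0 ∂τ ≤ ∫ y, max (u y - h y) 0 ∂τ := by
  calc ∫ y, max (l y - u y) 0 ∂τ ≤ ∫ y, (max (u y - h y) 0 + (h y - u y)) ∂τ := by
        refine integral_mono_ae (hl.sub hu).pos_part ((hu.sub hh).pos_part.add (hh.sub hu))
          (hlh.mono fun y hy => ?_)
        refine max_le ?_ ?_
        · linarith [le_max_right (u y - h y) 0]
        · linarith [le_max_left (u y - h y) 0]
    _ = ∫ y, max (u y - h y) 0 ∂τ := by
        rw [integral_add (f := fun y => max (u y - h y) 0) (g := fun y => h y - u y)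
          (hu.sub hh).pos_part (hh.sub hu), integral_sub hh hu, huh, sub_self, add_zero]

lemma exists_integral_mul_posPart_sub_eq {α : Type*} [MeasurableSpace α] {τ : Measure α}
    {l h u : α → ℝ} (hl : Integrable l τ) (hh : Integrable h τ) (hu : Integrable u τ)
    (hlh : l ≤ᵐ[τ] h) (huh : ∫ y, u y ∂τ = ∫ y, h y ∂τ) :
    ∃ θ : ℝ, 0 ≤ θ ∧ θ ≤ 1 ∧
      ∫ y, θ * max (u y - h y) 0 ∂τ = ∫ y, max (l y - u y) 0 ∂τ := by
  have hle := integral_posPart_sub_le hl hh hu hlh huh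
  have hnonneg : 0 ≤ ∫ y, max (l y - u y) 0 ∂τ := integral_nonneg fun _ => le_max_right _ _
  refine ⟨_, div_nonneg hnonneg (hnonneg.trans hle), div_le_one_of_le₀ hle (hnonneg.trans hle), ?_⟩
  rw [integral_const_mul, div_mul_cancel_of_imp fun h0 => le_antisymm (hle.trans_eq h0) hnonneg]

end Density

namespace IsMinimizer

variable {m : ℕ} {X : Set (E m)} {Y : Set ℝ} {c : E m → ℝ → ℝ} {C : ℝ} {μ : Measure (E m)}
  {f φ : ℝ → ℝ} {ν : Measure ℝ}

lemma absolutelyContinuous_and_integrableOn (hν : IsMinimizer Y c μ f ν) (hY : MeasurableSet Y)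
    (hY0 : volume Y ≠ 0) (hYfin : volume Y ≠ ⊤) :
    ν ≪ volume ∧ IntegrableOn (fun y => f (density ν y)) Y := by
  by_contra hinf
  have hmean : ∫ _ in Y, (volume.real Y)⁻¹ = 1 := by
    rw [setIntegral_const, smul_eq_mul, mul_inv_cancel₀ ((measureReal_ne_zero_iff hYfin).2 hY0)]
  have hle := hν.2 _ (ofDensity_mem_probOn_closure hY (integrableOn_const hYfin)
    (fun _ => inv_nonneg.2 measureReal_nonneg) hmean)
  rw [congestion_ofDensity hY measurable_const (fun _ => inv_nonneg.2 measureReal_nonneg)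
    (integrableOn_const hYfin), congestion, if_neg hinf, EReal.coe_add_top, ← EReal.coe_add,
    top_le_iff] at hle
  exact EReal.coe_ne_top _ hle

lemma ae_mem (hν : IsMinimizer Y c μ f ν) (hac : ν ≪ volume) (hfr : volume (frontier Y) = 0) :
    ∀ᵐ y ∂ν, y ∈ Y := by
  have hcl : ∀ᵐ y ∂ν, y ∈ closure Y := hν.1.2
  filter_upwards [hcl, measure_eq_zero_iff_ae_notMem.1 (hac hfr)] with y hy hyf
  exact interior_subset (by_contra fun hyi => hyf ⟨hy, hyi⟩)

lemma le_add_integral (hν : IsMinimizer Y c μ f ν) (hY : MeasurableSet Y) (hac : ν ≪ volume)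
    (hfν : IntegrableOn (fun y => f (density ν y)) Y) {u : ℝ → ℝ} (hu : Measurable u)
    (hu0 : ∀ y, 0 ≤ u y) (hui : IntegrableOn u Y) (hu1 : ∫ y in Y, u y = 1)
    (hfu : IntegrableOn (fun y => f (u y)) Y) :
    transportCost c μ ν + ∫ y in Y, f (density ν y) ≤
      transportCost c μ (ofDensity Y u) + ∫ y in Y, f (u y) := by
  have hle := hν.2 _ (ofDensity_mem_probOn_closure hY hui hu0 hu1)
  rw [congestion_ofDensity hY hu hu0 hfu, congestion, if_pos ⟨hac, hfν⟩] at hle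
  exact_mod_cast hle

lemma integral_le_of_transfer (hν : IsMinimizer Y c μ f ν) (hac : ν ≪ volume)
    (hfν : IntegrableOn (fun y => f (density ν y)) Y) (hνY : ∀ᵐ y ∂ν, y ∈ Y)
    [IsProbabilityMeasure μ] (hX : MeasurableSet X)
    (hY : MeasurableSet Y) (hc : ContinuousOn (Function.uncurry c) (X ×ˢ Y))
    (hC : ∀ p ∈ X ×ˢ Y, |Function.uncurry c p| ≤ C)
    (hφ : ∀ x ∈ X, ∀ y ∈ Y, ∀ y' ∈ Y, c x y' ≤ c x y + φ y + φ y') (hμX : ∀ᵐ x ∂μ, x ∈ X)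
    {r s : ℝ → ℝ} (hr : Measurable r) (hs : Measurable s) (hr0 : ∀ y, 0 ≤ r y)
    (hs0 : ∀ y, 0 ≤ s y) (hru : ∀ y, r y ≤ density ν y) (hri : IntegrableOn r Y)
    (hsi : IntegrableOn s Y) (hrs : ∫ y in Y, r y = ∫ y in Y, s y)
    (hrφ : IntegrableOn (fun y => r y * φ y) Y) (hsφ : IntegrableOn (fun y => s y * φ y) Y)
    (hf : IntegrableOn (fun y => f (density ν y - r y + s y)) Y) :
    ∫ y in Y, f (density ν y) ≤ (∫ y in Y, f (density ν y - r y + s y)) +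
      (∫ y in Y, r y * φ y) + ∫ y in Y, s y * φ y := by
  have hprob : IsProbabilityMeasure ν := hν.1.1
  have hkeep : Measurable fun y => density ν y - r y := (measurable_density ν).sub hr
  have hkeep0 : ∀ y, 0 ≤ density ν y - r y := fun y => sub_nonneg.2 (hru y)
  have hkeepi : IntegrableOn (fun y => density ν y - r y) Y :=
    integrable_density.integrableOn.sub hri
  have hsplit : ofDensity Y (fun y => density ν y - r y) + ofDensity Y r = ν := by
    simp only [← ofDensity_add hkeep hkeep0 hr0, sub_add_cancel]
    exact ofDensity_density hac hY hνY
  have hfinr := isFiniteMeasure_ofDensity hri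
  have hfins := isFiniteMeasure_ofDensity hsi
  have hprob' :
      IsProbabilityMeasure (ofDensity Y (fun y => density ν y - r y) + ofDensity Y r) := by
    rwa [hsplit]
  have hmass : ∫ y in Y, (density ν y - r y + s y) = 1 := by
    rw [integral_add hkeepi hsi, integral_sub integrable_density.integrableOn hri, hrs,
      sub_add_cancel, setIntegral_density_eq_one hac hY hνY]
  have hmin := hν.le_add_integral (u := fun y => density ν y - r y + s y) hY hac hfν
    (hkeep.add hs) (fun y => add_nonneg (hkeep0 y) (hs0 y)) (hkeepi.add hsi) hmass hf
  have hcost := transportCost_add_le (ν := ofDensity Y fun y => density ν y - r y) hX hY hc hC hφ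
    hμX (ae_mem_ofDensity hY) (ae_mem_ofDensity hY) (ae_mem_ofDensity hY)
    (by rw [ofDensity_univ hsi hs0, ofDensity_univ hri hr0, hrs])
    ((integrable_ofDensity_iff hr hr0).2 hrφ) ((integrable_ofDensity_iff hs hs0).2 hsφ)
  rw [hsplit, ← ofDensity_add hkeep hkeep0 hs0, integral_ofDensity hr hr0,
    integral_ofDensity hs hs0] at hcost
  linarith

lemma ae_eq_zero_of_transfer (hν : IsMinimizer Y c μ f ν) (hf : IsCongestionFunction f)
    (hac : ν ≪ volume) (hfν : IntegrableOn (fun y => f (density ν y)) Y) (hνY : ∀ᵐ y ∂ν, y ∈ Y)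
    [IsProbabilityMeasure μ] (hX : MeasurableSet X)
    (hY : MeasurableSet Y) (hYfin : volume Y ≠ ⊤) (hc : ContinuousOn (Function.uncurry c) (X ×ˢ Y))
    (hC : ∀ p ∈ X ×ˢ Y, |Function.uncurry c p| ≤ C)
    (hφ : ∀ x ∈ X, ∀ y ∈ Y, ∀ y' ∈ Y, c x y' ≤ c x y + φ y + φ y') (hμX : ∀ᵐ x ∂μ, x ∈ X)
    {r s : ℝ → ℝ} (hr : Measurable r) (hs : Measurable s) (hr0 : ∀ y, 0 ≤ r y)
    (hs0 : ∀ y, 0 ≤ s y) {k : ℝ} (hrh : ∀ y, r y ≤ max (density ν y - derivInv f (k + φ y)) 0)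
    (hsl : ∀ y, s y ≤ max (derivInv f (k - φ y) - density ν y) 0) (hri : IntegrableOn r Y)
    (hsi : IntegrableOn s Y) (hrs : ∫ y in Y, r y = ∫ y in Y, s y)
    (hrφ : IntegrableOn (fun y => r y * φ y) Y) (hsφ : IntegrableOn (fun y => s y * φ y) Y) :
    s =ᵐ[volume.restrict Y] 0 := by
  have hfin : IsFiniteMeasure (volume.restrict Y) := isFiniteMeasure_restrict.2 hYfin
  have hprob : IsProbabilityMeasure ν := hν.1.1
  set u := density ν
  have hu0 : ∀ y, 0 ≤ u y := density_nonneg ν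
  have hru : ∀ y, r y ≤ u y := fun y =>
    (hrh y).trans (max_le (by linarith [hf.derivInv_pos (k + φ y)]) (hu0 y))
  obtain ⟨x, hx⟩ := hμX.exists
  have hpq : ∀ y ∈ Y, k - φ y ≤ k + φ y := fun y hy => by linarith [hφ x hx y hy y hy]
  set G : ℝ → ℝ := fun y => f (u y) + (s y * k - s y * φ y) - (r y * k + r y * φ y) with hG
  have hsk : IntegrableOn (fun y => s y * k - s y * φ y) Y := (hsi.mul_const k).sub hsφ
  have hrk : IntegrableOn (fun y => r y * k + r y * φ y) Y := (hri.mul_const k).add hrφ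
  have hfsk : IntegrableOn (fun y => f (u y) + (s y * k - s y * φ y)) Y := hfν.add hsk
  have hGi : IntegrableOn G Y := hfsk.sub hrk
  have hGint : ∫ y in Y, G y =
      (∫ y in Y, f (u y)) - (∫ y in Y, r y * φ y) - ∫ y in Y, s y * φ y := by
    rw [hG, integral_sub hfsk hrk, integral_add hfν hsk,
      integral_sub (hsi.mul_const k) hsφ, integral_add (hri.mul_const k) hrφ, integral_mul_const,
      integral_mul_const, hrs]
    ring
  have hgain : ∀ᵐ y ∂volume.restrict Y, f (u y - r y + s y) ≤ G y :=
    (ae_restrict_mem hY).mono fun y hy =>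
      (hf.map_sub_add_le (hpq y hy) (hu0 y) (hr0 y) (hrh y) (hs0 y) (hsl y)).trans_eq (by ring)
  have hfi : IntegrableOn (fun y => f (u y - r y + s y)) Y :=
    hf.integrable_comp_of_le (((measurable_density ν).sub hr).add hs)
      (fun y => add_nonneg (sub_nonneg.2 (hru y)) (hs0 y))
      ((integrable_density.integrableOn.sub hri).add hsi) hGi hgain
  have hmin := hν.integral_le_of_transfer hac hfν hνY hX hY hc hC hφ hμX hr hs hr0 hs0 hru hri hsi
    hrs hrφ hsφ hfi
  have heq := (integral_eq_iff_of_ae_le hfi hGi hgain).1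
    (le_antisymm (integral_mono_ae hfi hGi hgain) (by linarith))
  filter_upwards [heq, ae_restrict_mem hY] with y hy hyY
  by_contra hne
  have hlt := hf.map_sub_add_lt (hpq y hyY) (hu0 y) (hr0 y) (hrh y) ((hs0 y).lt_of_ne' hne) (hsl y)
  simp only [hG] at hy
  linarith

lemma derivInv_sub_le_density (hν : IsMinimizer Y c μ f ν) (hf : IsCongestionFunction f)
    [IsProbabilityMeasure μ] (hX : MeasurableSet X)
    (hY : MeasurableSet Y) (hYfin : volume Y ≠ ⊤) (hfr : volume (frontier Y) = 0)
    (hc : ContinuousOn (Function.uncurry c) (X ×ˢ Y))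
    (hC : ∀ p ∈ X ×ˢ Y, |Function.uncurry c p| ≤ C) (hφm : Measurable φ) {B : ℝ}
    (hφB : ∀ y ∈ Y, φ y ≤ B)
    (hφ : ∀ x ∈ X, ∀ y ∈ Y, ∀ y' ∈ Y, c x y' ≤ c x y + φ y + φ y') (hμX : ∀ᵐ x ∂μ, x ∈ X)
    {k : ℝ} (hk : ∫ y in Y, derivInv f (k + φ y) = 1) :
    ∀ᵐ y ∂volume.restrict Y, derivInv f (k - φ y) ≤ density ν y := by
  have hprob : IsProbabilityMeasure ν := hν.1.1
  have hY0 : volume Y ≠ 0 := fun h0 => by simp [Measure.restrict_eq_zero.2 h0] at hk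
  obtain ⟨hac, hfν⟩ := hν.absolutelyContinuous_and_integrableOn hY hY0 hYfin
  have hνY := hν.ae_mem hac hfr
  obtain ⟨x, hx⟩ := hμX.exists
  have hφ0 : ∀ y ∈ Y, 0 ≤ φ y := fun y hy => by linarith [hφ x hx y hy y hy]
  set u := density ν
  set l : ℝ → ℝ := fun y => derivInv f (k - φ y)
  set h : ℝ → ℝ := fun y => derivInv f (k + φ y)
  have hu : Measurable u := measurable_density ν
  have hl : Measurable l := hf.continuous_derivInv.measurable.comp (hφm.const_sub k)
  have hh : Measurable h := hf.continuous_derivInv.measurable.comp (hφm.const_add k)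
  have hui : IntegrableOn u Y := integrable_density.integrableOn
  have hhi : IntegrableOn h Y := integrable_of_integral_eq_one hk
  have hlh : l ≤ᵐ[volume.restrict Y] h := (ae_restrict_mem hY).mono fun y hy =>
    hf.strictMono_derivInv.monotone (by linarith [hφ0 y hy])
  have hli : IntegrableOn l Y := hhi.mono' hl.aestronglyMeasurable
    (hlh.mono fun y hy => by rwa [Real.norm_of_nonneg (hf.derivInv_pos _).le])
  have hmulφ : ∀ {w : ℝ → ℝ}, IntegrableOn w Y → IntegrableOn (fun y => w y * φ y) Y := fun hw =>
    hw.mul_bdd (c := B) hφm.aestronglyMeasurable ((ae_restrict_mem hY).mono fun y hy => by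
      rw [Real.norm_of_nonneg (hφ0 y hy)]
      exact hφB y hy)
  obtain ⟨θ, hθ0, hθ1, hθ⟩ := exists_integral_mul_posPart_sub_eq hli hhi hui hlh
    ((setIntegral_density_eq_one hac hY hνY).trans hk.symm)
  have hdeficit : IntegrableOn (fun y => max (l y - u y) 0) Y := (hli.sub hui).pos_part
  have hexcess : IntegrableOn (fun y => θ * max (u y - h y) 0) Y :=
    (hui.sub hhi).pos_part.const_mul θ
  have hzero := hν.ae_eq_zero_of_transfer hf hac hfν hνY hX hY hYfin hc hC hφ hμX (k := k)
    (((hu.sub hh).max measurable_const).const_mul θ) ((hl.sub hu).max measurable_const)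
    (fun y => mul_nonneg hθ0 (le_max_right _ _)) (fun _ => le_max_right _ _)
    (fun y => mul_le_of_le_one_left (le_max_right _ _) hθ1) (fun _ => le_rfl)
    hexcess hdeficit hθ (hmulφ hexcess) (hmulφ hdeficit)
  exact hzero.mono fun y hy => sub_nonpos.1 (max_eq_right_iff.1 hy)

end IsMinimizer

section Nested

variable {m : ℕ} {X : Set (E m)} {Y : Set ℝ} {c : E m → ℝ → ℝ} {μ : Measure (E m)}
  {f : ℝ → ℝ} {ν : Measure ℝ} {b y₀ y₁ k₀ k₁ C M : ℝ}

lemma IsCongestionFunction.antitone_lowerBound (hf : IsCongestionFunction f) (Y : Set ℝ)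
    (hM : 0 ≤ M) : Antitone (lowerBound f Y M) := fun _ _ h =>
  hf.strictMono_derivInv.monotone (by linarith [mul_le_mul_of_nonneg_left h hM])

lemma IsMinimizer.lowerBound_le_density (hν : IsMinimizer (Set.Ioo 0 b) c μ f ν)
    (hf : IsCongestionFunction f) [IsProbabilityMeasure μ] (hX : MeasurableSet X) (hb : 0 < b)
    (hc : ContinuousOn (Function.uncurry c) (X ×ˢ Set.Ioo 0 b))
    (hC : ∀ p ∈ X ×ˢ Set.Ioo 0 b, |Function.uncurry c p| ≤ C) (hM : 0 ≤ M)
    (hcM : ∀ x ∈ X, ∀ y ∈ Set.Ioo 0 b, ∀ y' ∈ Set.Ioo 0 b, |c x y - c x y'| ≤ M * |y - y'|)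
    (hμX : ∀ᵐ x ∂μ, x ∈ X) :
    ∀ᵐ y ∂volume.restrict (Set.Ioo 0 b), lowerBound f (Set.Ioo 0 b) M y ≤ density ν y := by
  have hfr : volume (frontier (Set.Ioo 0 b)) = 0 := by
    rw [frontier_Ioo hb]
    exact (Set.toFinite _).measure_zero _
  have hcost : ∀ x ∈ X, ∀ y ∈ Set.Ioo 0 b, ∀ y' ∈ Set.Ioo 0 b,
      c x y' ≤ c x y + M * y + M * y' := fun x hx y hy y' hy' => by
    have hdist : M * |y' - y| ≤ M * (y + y') :=
      mul_le_mul_of_nonneg_left (abs_le.2 ⟨by linarith [hy'.1], by linarith [hy.1]⟩) hM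
    linarith [(abs_le.1 (hcM x hx y' hy' y hy)).2]
  have hmass : ∫ y in Set.Ioo 0 b,
      derivInv f (K f (Set.Ioo 0 b) (fun t => -(M * t)) 1 + M * y) = 1 := by
    simpa only [sub_neg_eq_add] using
      hf.integral_derivInv_K hb one_pos (v := fun t => -(M * t)) (by fun_prop)
  exact hν.derivInv_sub_le_density hf hX measurableSet_Ioo (by simp) hfr hc hC (by fun_prop)
    (fun y hy => mul_le_mul_of_nonneg_left hy.2.le hM) hcost hμX hmass

lemma IsMinimizer.lipConst_lowerBound_le_density [IsProbabilityMeasure μ]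
    (hν : IsMinimizer (Set.Ioo 0 b) c μ f ν) (hf : IsCongestionFunction f) (hXo : IsOpen X)
    (hXb : Bornology.IsBounded X) (hb : 0 < b)
    (hc : IsC2OnClosure (X ×ˢ Set.Ioo 0 b) (Function.uncurry c)) (hμX : ∀ᵐ x ∂μ, x ∈ X) :
    ∀ᵐ y ∂volume.restrict (Set.Ioo 0 b),
      lowerBound f (Set.Ioo 0 b) (lipConst X (Set.Ioo 0 b) c) y ≤ density ν y := by
  have hYb : Bornology.IsBounded (Set.Ioo 0 b) := Metric.isBounded_Ioo 0 b
  obtain ⟨C, hC⟩ := (hXb.prod hYb).isCompact_closure.exists_bound_of_continuousOn hc.continuousOn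
  exact hν.lowerBound_le_density hf hXo.measurableSet hb (hc.continuousOn.mono subset_closure)
    (fun p hp => hC p (subset_closure hp)) lipConst_nonneg
    (fun x hx y hy y' hy' => abs_sub_le_lipConst_mul hXo hXb isOpen_Ioo hYb (convex_Ioo 0 b) hc
      (subset_closure hx) (subset_closure hy) (subset_closure hy')) hμX

lemma sub_mul_lowerBound_le_measureReal_Ioc [IsFiniteMeasure ν] (hac : ν ≪ volume)
    (hf : IsCongestionFunction f) (hM : 0 ≤ M)
    (hdens : ∀ᵐ y ∂volume.restrict Y, lowerBound f Y M y ≤ density ν y) (hy : y₀ ≤ y₁)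
    (hsub : Set.Ioc y₀ y₁ ⊆ Y) :
    (y₁ - y₀) * lowerBound f Y M y₁ ≤ ν.real (Set.Ioc y₀ y₁) := by
  calc (y₁ - y₀) * lowerBound f Y M y₁
      = ∫ _ in Set.Ioc y₀ y₁, lowerBound f Y M y₁ := by
        rw [setIntegral_const, Real.volume_real_Ioc_of_le hy, smul_eq_mul]
    _ ≤ ∫ y in Set.Ioc y₀ y₁, density ν y := by
        refine integral_mono_ae (integrableOn_const (by simp))
          integrable_density.integrableOn ?_
        filter_upwards [ae_restrict_of_ae_restrict_of_subset hsub hdens,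
          ae_restrict_mem measurableSet_Ioc] with y hy hyI
        exact (hf.antitone_lowerBound Y hM hyI.2).trans hy
    _ = ν.real (Set.Ioc y₀ y₁) := setIntegral_density hac _

lemma superGE_subset_kMax (hC : ∀ x ∈ X, |dy c x y₁| ≤ C) :
    superGE X c y₀ k₀ ⊆ superGE X c y₁ (kMax X c y₀ y₁ k₀) :=
  fun _ hx => ⟨hx.1, csSup_le ⟨-C, fun w hw => ⟨hw.1, (abs_le.1 (hC w hw.1)).1⟩⟩
    fun _ hk => (hk hx).2⟩

lemma lt_kMax_of_minMassDiff_lt [IsFiniteMeasure μ] [IsFiniteMeasure ν] (hy : y₀ ≤ y₁)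
    (hsub : superGE X c y₀ k₀ ⊆ superGE X c y₁ (kMax X c y₀ y₁ k₀))
    (hmeas : MeasurableSet (superGE X c y₀ k₀))
    (h₀ : μ (superGE X c y₀ k₀) = ν (Set.Iic y₀)) (h₁ : μ (superGE X c y₁ k₁) = ν (Set.Iic y₁))
    (hlt : minMassDiff X c μ y₀ y₁ k₀ < ν.real (Set.Ioc y₀ y₁)) :
    k₁ < kMax X c y₀ y₁ k₀ := by
  by_contra! hle
  have hmono : μ.real (superGE X c y₁ k₁) ≤ μ.real (superGE X c y₁ (kMax X c y₀ y₁ k₀)) :=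
    measureReal_mono fun x hx => ⟨hx.1, hle.trans hx.2⟩
  rw [minMassDiff, measureReal_sdiff hsub hmeas, ← Set.Iic_sdiff_Iic,
    measureReal_sdiff (Set.Iic_subset_Iic.2 hy) measurableSet_Iic, measureReal_def ν,
    measureReal_def ν, ← h₀, ← h₁, ← measureReal_def, ← measureReal_def] at hlt
  linarith

lemma superGE_subset_superGT [IsFiniteMeasure μ] [IsFiniteMeasure ν] (hy : y₀ ≤ y₁)
    (hC : ∀ x ∈ X, |dy c x y₁| ≤ C) (hmeas : MeasurableSet (superGE X c y₀ k₀))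
    (h₀ : μ (superGE X c y₀ k₀) = ν (Set.Iic y₀)) (h₁ : μ (superGE X c y₁ k₁) = ν (Set.Iic y₁))
    (hlt : minMassDiff X c μ y₀ y₁ k₀ < ν.real (Set.Ioc y₀ y₁)) :
    superGE X c y₀ k₀ ⊆ superGT X c y₁ k₁ := by
  have hsub := superGE_subset_kMax (y₀ := y₀) (k₀ := k₀) hC
  exact fun x hx =>
    ⟨hx.1, (lt_kMax_of_minMassDiff_lt hy hsub hmeas h₀ h₁ hlt).trans_le (hsub hx).2⟩

lemma minMassDiff_lt_of_iSup_neg (hy₁ : y₁ ∈ Y) (hlt : y₀ < y₁) (k₀ : ℝ) (g : ℝ → ℝ)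
    (hsup : (⨆ (y₁ ∈ Y) (_ : y₀ < y₁) (y ∈ Set.Icc y₀ y₁),
      ((minMassDiff X c μ y₀ y₁ k₀ / (y₁ - y₀) - g y : ℝ) : EReal)) < 0) :
    minMassDiff X c μ y₀ y₁ k₀ < (y₁ - y₀) * g y₁ := by
  have hneg : ((minMassDiff X c μ y₀ y₁ k₀ / (y₁ - y₀) - g y₁ : ℝ) : EReal) < 0 :=
    (le_iSup₂_of_le y₁ hy₁ (le_iSup_of_le hlt
      (le_iSup₂_of_le y₁ (Set.right_mem_Icc.2 hlt.le) (le_refl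
        ((minMassDiff X c μ y₀ y₁ k₀ / (y₁ - y₀) - g y₁ : ℝ) : EReal))))).trans_lt hsup
  rw [mul_comm, ← div_lt_iff₀ (sub_pos.2 hlt), ← sub_neg]
  exact_mod_cast hneg

end Nested

end Congestion

theorem mainTheorem5_general {m : ℕ} (X : Set (Congestion.E m)) (hXo : IsOpen X)
    (hXb : Bornology.IsBounded X) (ybar : ℝ) (hybar : 0 < ybar) (Y : Set ℝ)
    (hY : Y = Set.Ioo 0 ybar) (c : Congestion.E m → ℝ → ℝ)
    (hc : Congestion.IsC2OnClosure (X ×ˢ Y) (fun p : Congestion.E m × ℝ => c p.1 p.2))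
    (hmixed : ∀ p ∈ X ×ˢ Y, Congestion.mixed c p ≠ 0)
    (μ : Measure (Congestion.E m)) [IsProbabilityMeasure μ] (hμX : μ Xᶜ = 0) (hμ : μ ≪ volume)
    (f : ℝ → ℝ) (hf : Congestion.IsCongestionFunction f)
    (ν : Measure ℝ) (hν : Congestion.IsMinimizer Y c μ f ν) :
    (∃ k : ℝ → ℝ, Congestion.IsSplitting X Y c μ ν k) ∧
    ∀ k : ℝ → ℝ, Congestion.IsSplitting X Y c μ ν k → ∀ y₀ ∈ Y, ∀ y₁ ∈ Y, y₀ < y₁ →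
      Congestion.minMassDiff X c μ y₀ y₁ (k y₀) <
        (y₁ - y₀) * Congestion.lowerBound f Y (Congestion.lipConst X Y c) y₁ →
      Congestion.superGE X c y₀ (k y₀) ⊆ Congestion.superGT X c y₁ (k y₁) := by
  subst hY
  have hYb : Bornology.IsBounded (Set.Ioo 0 ybar) := Metric.isBounded_Ioo 0 ybar
  have hprob : IsProbabilityMeasure ν := hν.1.1
  have hμX' : μ X = 1 := (prob_compl_eq_zero_iff hXo.measurableSet).1 hμX
  refine ⟨Congestion.exists_isSplitting hXo hXb isOpen_Ioo hYb hc hmixed hμ (by simp [hμX']),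
    fun k hk y₀ hy₀ y₁ hy₁ hlt hdiff => ?_⟩
  obtain ⟨C, hC⟩ := Congestion.exists_dy_bound hXo hXb isOpen_Ioo hYb hc
  have hac := (hν.absolutelyContinuous_and_integrableOn measurableSet_Ioo
    (by simpa using hybar) (by simp)).1
  have hdens := hν.lipConst_lowerBound_le_density hf hXo hXb hybar hc hμX
  have hmass := Congestion.sub_mul_lowerBound_le_measureReal_Ioc hac hf
    Congestion.lipConst_nonneg hdens hlt.le fun y hy => ⟨hy₀.1.trans hy.1, hy.2.trans_lt hy₁.2⟩
  exact Congestion.superGE_subset_superGT hlt.le (fun x hx => hC x hx y₁ hy₁)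
    (Congestion.measurableSet_superGE hXo isOpen_Ioo (hc.contDiffOn.of_le one_le_two) hy₀ _)
    (hk y₀ hy₀) (hk y₁ hy₁) (hdiff.trans_le hmass)

theorem mainTheorem5 {m : ℕ} (hm : 1 < m)
    (X : Set (Congestion.E m)) (hXo : IsOpen X) (hXb : Bornology.IsBounded X)
    (ybar : ℝ) (hybar : 0 < ybar) (Y : Set ℝ) (hY : Y = Set.Ioo 0 ybar)
    (c : Congestion.E m → ℝ → ℝ)
    (hc : Congestion.IsC2OnClosure (X ×ˢ Y) (fun p : Congestion.E m × ℝ => c p.1 p.2))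
    (htwist : Congestion.Twist X Y c) (hnondeg : Congestion.Nondegenerate X Y c)
    (μ : Measure (Congestion.E m)) [IsProbabilityMeasure μ] (hμX : μ Xᶜ = 0) (hμ : μ ≪ volume)
    (f : ℝ → ℝ) (hf : Congestion.IsCongestionFunction f)
    (ν : Measure ℝ) (hν : Congestion.IsMinimizer Y c μ f ν) :
    (∃ k : ℝ → ℝ, Congestion.IsSplitting X Y c μ ν k) ∧
    ∀ k : ℝ → ℝ, Congestion.IsSplitting X Y c μ ν k →
      (∀ y₀ ∈ Y,
        (⨆ (y₁ ∈ Y) (_ : y₀ < y₁) (y ∈ Set.Icc y₀ y₁),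
          ((Congestion.minMassDiff X c μ y₀ y₁ (k y₀) / (y₁ - y₀)
            - Congestion.lowerBound f Y (Congestion.lipConst X Y c) y : ℝ) : EReal)) < 0) →
      Congestion.IsNested X Y c ν k := by
  have hmixed := fun p => hnondeg.mixed_ne_zero hXo (hY ▸ isOpen_Ioo) hc.contDiffOn (p := p)
  obtain ⟨hex, hnest⟩ :=
    mainTheorem5_general X hXo hXb ybar hybar Y hY c hc hmixed μ hμX hμ f hf ν hν
  exact ⟨hex, fun k hk hsup y₀ hy₀ y₁ hy₁ hlt _ => hnest k hk y₀ hy₀ y₁ hy₁ hlt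
    (Congestion.minMassDiff_lt_of_iSup_neg hy₁ hlt (k y₀) _ (hsup y₀ hy₀))⟩
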